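/- Let $M$ be a smooth manifold of dimension $n$ (Hausdorff, second countable, without boundary), let $\mathcal V^k(M)$ be the space of smooth $k$-vector fields on $M$ (with $\mathcal V^{-1}(M)=0$), and let $[\;,\;]$ be the Schouten–Nijenhuis bracket, with the sign convention $[X,Q]=\mathcal L_XQ$ for vector fields $X$ and $[P,Q]=(-1)^{pq}[Q,P]$ for $P\in\mathcal V^p(M)$, $Q\in\mathcal V^q(M)$. A Jacobi structure on $M$ is a pair $(\Lambda,E)$ of a $2$-vector field $\Lambda$ and a vector field $E$ such that $[\Lambda,\Lambda]=2E\wedge\Lambda$ and $[E,\Lambda]=0$. Its Lichnerowicz–Jacobi cohomology $H^*_{LJ}(M,\Lambda,E)$ is the cohomology of the complex of real vector spaces $(\mathcal V^k(M)\oplus\mathcal V^{k-1}(M))_{k\ge 0}$ with the differential $$\sigma(P,Q)=\bigl(-[\Lambda,P]+kE\wedge P+\Lambda\wedge Q,\;[\Lambda,Q]-(k-1)E\wedge Q+[E,P]\bigr),\qquad (P,Q)\in\mathcal V^k(M)\oplus\mathcal V^{k-1}(M).$$ **Theorem.** Let $(\Lambda,E)$ be a Jacobi structure on $M$, let $a$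 be a positive $C^\infty$ real-valued function on $M$, and let $(\Lambda_a,E_a)$ be the conformal change of $(\Lambda,E)$ given by $$\Lambda_a=a\Lambda,\qquad E_a=\#_\Lambda(da)+aE,\qquad\text{where } (\#_\Lambda(\alpha))(\beta)=\Lambda(\alpha,\beta).$$ Then $(\Lambda_a,E_a)$ is again a Jacobi structure on $M$, and for every $k\ge 0$ there is an isomorphism of real vector spaces $$H^k_{LJ}(M,\Lambda,E)\cong H^k_{LJ}(M,\Lambda_a,E_a).$$ -/

import Mathlib

open scoped Manifold ContDiff

noncomputable section

namespace LichnerowiczJacobi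

/-! ### Exterior products of alternating maps -/

section Algebra

variable {A N₁ N₂ N₃ : Type*} [AddCommGroup A] [Module ℝ A] [AddCommGroup N₁] [Module ℝ N₁]
  [AddCommGroup N₂] [Module ℝ N₂] [AddCommGroup N₃] [Module ℝ N₃]

/-- The exterior product `P ∧ Q` of two alternating maps with values in `N₁` and `N₂`, with respect
to a bilinear pairing `μ : N₁ × N₂ → N₃`. It is the signed sum over shuffles
`(P ∧ Q)(f₁, …, f_{p+q}) = ∑ sign(s) μ (P(f_{s 1}, …, f_{s p})) (Q(f_{s (p+1)}, …, f_{s (p+q)}))`,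
the sum being over the permutations `s` which are increasing on `{1, …, p}` and on
`{p+1, …, p+q}`. Splitting the sum according to an entry of `P` gives the recursion
`(P ∧ Q)(f₀, …, f_{p+q}) = (p+1)⁻¹ ∑ᵢ (-1)ⁱ (P(fᵢ, ·) ∧ Q)(f₀, …, f̂ᵢ, …, f_{p+q})`
for `P` of degree `p + 1`, which is used as the definition. -/
def wedge (μ : N₁ →ₗ[ℝ] N₂ →ₗ[ℝ] N₃) {q : ℕ} : (p : ℕ) →
    (A [⋀^Fin p]→ₗ[ℝ] N₁) →ₗ[ℝ] (A [⋀^Fin q]→ₗ[ℝ] N₂) →ₗ[ℝ] (A [⋀^Fin (q + p)]→ₗ[ℝ] N₃)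
  | 0 => LinearMap.mk₂ ℝ (fun P Q => (μ (P Fin.elim0)).compAlternatingMap Q)
      (fun _ _ _ => by ext; simp) (fun _ _ _ => by ext; simp)
      (fun _ _ _ => by ext; simp) (fun _ _ _ => by ext; simp)
  | p + 1 => LinearMap.mk₂ ℝ
      (fun P Q => ((p : ℝ) + 1)⁻¹ •
        AlternatingMap.alternatizeUncurryFin ((wedge μ p).flip Q ∘ₗ P.curryLeft))
      (fun _ _ _ => by simp [LinearMap.comp_add])
      (fun c _ _ => by simp [LinearMap.comp_smul, smul_comm c])
      (fun _ _ _ => by simp [LinearMap.add_comp])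
      (fun c _ _ => by simp [LinearMap.smul_comp, smul_comm c])

/-- For `P` of degree `p + 1`, the alternating map `P♭` of degree `p` with values in the linear
endomorphisms, `P♭(f₁, …, f_p) = (g ↦ P(g, f₁, …, f_p))`. -/
def flat {p : ℕ} : (A [⋀^Fin (p + 1)]→ₗ[ℝ] A) →ₗ[ℝ] (A [⋀^Fin p]→ₗ[ℝ] (A →ₗ[ℝ] A)) where
  toFun P :=
    { toFun := fun f =>
        { toFun := fun g => P.curryLeft g f
          map_add' := fun g h => by rw [map_add]; rfl
          map_smul' := fun c g => by rw [map_smul]; rfl }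
      map_update_add' := fun f i x y => by
        ext g; exact (P.curryLeft g).map_update_add f i x y
      map_update_smul' := fun f i c x => by
        ext g; exact (P.curryLeft g).map_update_smul f i c x
      map_eq_zero_of_eq' := fun f i j h hij => by
        ext g; exact (P.curryLeft g).map_eq_zero_of_eq f h hij }
  map_add' _ _ := rfl
  map_smul' _ _ := rfl

/-- The Schouten-Nijenhuis bracket `[P, Q]` of `P` of degree `p + 1` and `Q` of degree `q`, an
alternating map of degree `p + q`, for multivector fields regarded as alternating maps acting on
functions: `[P, Q] = P♭ ∧ Q + (-1)^(p+1) P ∧ Q♭`, where the first product composes (the value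
of `Q` is plugged into the first slot of `P`) and so does the second (the value of `P` is plugged
into the first slot of `Q`). For `Q` of degree `0` there is no second term.

The sign convention is that of Lichnerowicz and Vaisman: `[X, Q] = ℒ_X Q` for a vector field `X`,
`[P, Q] = (-1)^{(deg P)(deg Q)} [Q, P]`, and, for a bivector field `P`,
`-[P, Q](f₀, …, f_q) = ∑ᵢ (-1)ⁱ P(fᵢ, Q(…, f̂ᵢ, …)) + ∑_{i<j} (-1)^{i+j} Q(P(fᵢ, fⱼ), …)`. -/
def schouten {p : ℕ} (P : A [⋀^Fin (p + 1)]→ₗ[ℝ] A) : {q : ℕ} →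
    (A [⋀^Fin q]→ₗ[ℝ] A) →ₗ[ℝ] (A [⋀^Fin (q + p)]→ₗ[ℝ] A)
  | 0 => wedge LinearMap.id p (flat P)
  | q + 1 => wedge LinearMap.id p (flat P) + (-1 : ℝ) ^ (p + 1) •
      ((AlternatingMap.domDomCongrₗ ℝ (finCongr (by omega : q + (p + 1) = q + 1 + p))).toLinearMap
        ∘ₗ wedge LinearMap.id.flip (p + 1) P ∘ₗ flat)

end Algebra

/-! ### Multivector fields -/

section Manifold

universe u

variable (n : ℕ) (M : Type u) [TopologicalSpace M] [ChartedSpace (EuclideanSpace ℝ (Fin n)) M]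

/-- The algebra `C^∞(M, ℝ)`. -/
abbrev SmoothFun : Type _ := C^∞⟮𝓡 n, M; 𝓘(ℝ, ℝ), ℝ⟯

/-- The cotangent space `T*ₓM`. -/
abbrev Cotangent (x : M) : Type := TangentSpace (𝓡 n) x →L[ℝ] ℝ

variable {n M} in
/-- The differential `df(x) ∈ T*ₓM` of a smooth function. -/
def differential (f : SmoothFun n M) (x : M) : Cotangent n M x :=
  mfderiv (𝓡 n) 𝓘(ℝ, ℝ) f x

/-- Skew-symmetric `ℝ`-multilinear maps `C^∞(M, ℝ) × ⋯ × C^∞(M, ℝ) → C^∞(M, ℝ)`. -/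
abbrev Alt (k : ℕ) : Type u := SmoothFun n M [⋀^Fin k]→ₗ[ℝ] SmoothFun n M

instance instAddCommGroupAlt (k : ℕ) : AddCommGroup (Alt n M k) := inferInstance

instance instModuleAlt (k : ℕ) : Module ℝ (Alt n M k) := inferInstance

/-- The space `𝒱ᵏ(M)` of (smooth) `k`-vector fields on `M`. A `k`-vector at `x`, an element of
`Λᵏ TₓM`, is a skew-symmetric `k`-linear form `Pₓ` on `T*ₓM`; a field `x ↦ Pₓ` of `k`-vectors is
smooth iff `x ↦ Pₓ(df₁(x), …, df_k(x))` is smooth for all smooth functions `f₁, …, f_k`, and it is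
determined by these functions. So a `k`-vector field is recorded by its action
`(f₁, …, f_k) ↦ P(df₁, …, df_k)`. -/
def multivectorFields (k : ℕ) : Submodule ℝ (Alt n M k) where
  carrier := {D | ∃ P : (x : M) → (Cotangent n M x) [⋀^Fin k]→ₗ[ℝ] ℝ,
    ∀ (f : Fin k → SmoothFun n M) (x : M), D f x = P x (fun i => differential (f i) x)}
  zero_mem' := ⟨fun _ => 0, fun _ _ => rfl⟩
  add_mem' := by
    rintro D D' ⟨P, hP⟩ ⟨P', hP'⟩
    exact ⟨fun x => P x + P' x, fun f x => by simp [hP, hP']⟩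
  smul_mem' := by
    rintro c D ⟨P, hP⟩
    exact ⟨fun x => c • P x, fun f x => by simp [hP]⟩

variable {n M}

/-- The exterior product of multivector fields. -/
abbrev wedgeProd {p q : ℕ} (P : Alt n M p) : Alt n M q →ₗ[ℝ] Alt n M (q + p) :=
  wedge (LinearMap.mul ℝ (SmoothFun n M)) p P

/-! ### Jacobi structures -/

/-- `(Λ, E)` is a Jacobi structure on `M`: `Λ` is a bivector field, `E` is a vector field,
`[Λ, Λ] = 2 E ∧ Λ` and `[E, Λ] = 0`. -/
structure IsJacobi (Λ : Alt n M 2) (E : Alt n M 1) : Prop where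
  bivector : Λ ∈ multivectorFields n M 2
  vector : E ∈ multivectorFields n M 1
  schouten_self : schouten (p := 1) Λ Λ = (2 : ℝ) • wedgeProd E Λ
  schouten_vector : schouten (p := 0) E Λ = 0

/-- The bivector field `Λₐ = a Λ`. -/
def conformalBivector (Λ : Alt n M 2) (a : SmoothFun n M) : Alt n M 2 := a • Λ

/-- The vector field `Eₐ = #_Λ(da) + a E`, where `#_Λ(α)(β) = Λ(α, β)`. -/
def conformalVector (Λ : Alt n M 2) (E : Alt n M 1) (a : SmoothFun n M) : Alt n M 1 :=
  Λ.curryLeft a + a • E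

/-! ### Lichnerowicz-Jacobi cohomology -/

variable (n M) in
/-- The second component of a pair of degree `k`: it has degree `k - 1`, and is zero if `k = 0`. -/
def LowerAlt : ℕ → Type u
  | 0 => PUnit.{u + 1}
  | k + 1 => Alt n M k

instance instAddCommGroupLowerAlt : (k : ℕ) → AddCommGroup (LowerAlt n M k)
  | 0 => (inferInstance : AddCommGroup PUnit.{u + 1})
  | k + 1 => (inferInstance : AddCommGroup (Alt n M k))

instance instModuleLowerAlt : (k : ℕ) → Module ℝ (LowerAlt n M k)
  | 0 => (inferInstance : Module ℝ PUnit.{u + 1})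
  | k + 1 => (inferInstance : Module ℝ (Alt n M k))

variable (n M) in
/-- The space `𝒱^{k-1}(M)`, with `𝒱^{-1}(M) = 0`. -/
def lowerMultivectorFields : (k : ℕ) → Submodule ℝ (LowerAlt n M k)
  | 0 => ⊤
  | k + 1 => multivectorFields n M k

variable (n M) in
/-- The space `𝒱ᵏ(M) ⊕ 𝒱^{k-1}(M)` of `k`-cochains of the Lichnerowicz-Jacobi complex. -/
def cochains (k : ℕ) : Submodule ℝ (Alt n M k × LowerAlt n M k) :=
  (multivectorFields n M k).prod (lowerMultivectorFields n M k)

/-- The Lichnerowicz-Jacobi operator in degree `0`, `σ(P, 0) = (-[Λ, P], [E, P])`. -/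
def sigmaZero (Λ : Alt n M 2) (E : Alt n M 1) :
    (Alt n M 0 × PUnit.{u + 1}) →ₗ[ℝ] (Alt n M 1 × Alt n M 0) :=
  LinearMap.prod
    (-(schouten (p := 1) Λ ∘ₗ LinearMap.fst ℝ _ _))
    (schouten (p := 0) E ∘ₗ LinearMap.fst ℝ _ _)

/-- The Lichnerowicz-Jacobi operator in degree `k + 1`,
`σ(P, Q) = (-[Λ, P] + (k + 1) E ∧ P + Λ ∧ Q, [Λ, Q] - k E ∧ Q + [E, P])`. -/
def sigmaSucc (Λ : Alt n M 2) (E : Alt n M 1) (k : ℕ) :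
    (Alt n M (k + 1) × Alt n M k) →ₗ[ℝ] (Alt n M (k + 2) × Alt n M (k + 1)) :=
  LinearMap.prod
    (-(schouten (p := 1) Λ ∘ₗ LinearMap.fst ℝ _ _)
      + ((k : ℝ) + 1) • (wedgeProd E ∘ₗ LinearMap.fst ℝ _ _)
      + wedgeProd Λ ∘ₗ LinearMap.snd ℝ _ _)
    (schouten (p := 1) Λ ∘ₗ LinearMap.snd ℝ _ _
      - (k : ℝ) • (wedgeProd E ∘ₗ LinearMap.snd ℝ _ _)
      + schouten (p := 0) E ∘ₗ LinearMap.fst ℝ _ _)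

/-- The Lichnerowicz-Jacobi operator
`σ(P, Q) = (-[Λ, P] + k E ∧ P + Λ ∧ Q, [Λ, Q] - (k - 1) E ∧ Q + [E, P])` in degree `k`. -/
def sigma (Λ : Alt n M 2) (E : Alt n M 1) : (k : ℕ) →
    (Alt n M k × LowerAlt n M k) →ₗ[ℝ] (Alt n M (k + 1) × LowerAlt n M (k + 1))
  | 0 => sigmaZero Λ E
  | k + 1 => sigmaSucc Λ E k

/-- The `k`-cocycles: the kernel of `σ : 𝒱ᵏ(M) ⊕ 𝒱^{k-1}(M) → 𝒱^{k+1}(M) ⊕ 𝒱ᵏ(M)`. -/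
def cocycles (Λ : Alt n M 2) (E : Alt n M 1) (k : ℕ) :
    Submodule ℝ (Alt n M k × LowerAlt n M k) :=
  cochains n M k ⊓ LinearMap.ker (sigma Λ E k)

/-- The `k`-coboundaries: the image of `σ : 𝒱^{k-1}(M) ⊕ 𝒱^{k-2}(M) → 𝒱ᵏ(M) ⊕ 𝒱^{k-1}(M)`, which
is zero for `k = 0`. -/
def coboundaries (Λ : Alt n M 2) (E : Alt n M 1) : (k : ℕ) →
    Submodule ℝ (Alt n M k × LowerAlt n M k)
  | 0 => ⊥
  | k + 1 => (cochains n M k).map (sigma Λ E k)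

/-- The Lichnerowicz-Jacobi cohomology space `Hᵏ_LJ(M, Λ, E)`: cocycles modulo coboundaries. -/
abbrev LJCohomology (Λ : Alt n M 2) (E : Alt n M 1) (k : ℕ) : Type _ :=
  cocycles Λ E k ⧸ (coboundaries Λ E k).submoduleOf (cocycles Λ E k)

end Manifold

end LichnerowiczJacobi

end

/-! A pair $(P,Q)$ encodes the first order operator
$D(f_1,\dots,f_k)=P(df_1,\dots,df_k)+\sum_i(-1)^{i-1}f_i\,Q(\dots,\widehat{df_i},\dots)$. In
particular $(\Lambda,E)$ encodes the Jacobi bracket $\{f,g\}$, and the conformal change encodes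
$a^{-1}\{af,ag\}$. Substituting $af_i$ for $f_i$ therefore should carry one complex to the other. On
pairs it reads $(P,Q)\mapsto(a^kP,\;a^kQ+a^{k-1}i_{da}P)$, which is `rescale`; it is invertible
because $a$ has no zeros.

That this map commutes with the two operators is `sigma_rescale`, which rests on `conformal_fst` and
`conformal_snd`. They follow from the Leibniz rules for $[h\Lambda,P]$, $[\Lambda,hP]$, $[hX,P]$ and
$[X,hP]$. The Leibniz rules are proved by induction on the degree: an alternating map of positive
degree is determined by its contractions $i_g$, and $i_g$ of a bracket or wedge is expressed through
operations on contracted arguments (`contract_schouten_bivector`, `contract_wedge_two` and their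
analogues). -/

noncomputable section

namespace LichnerowiczJacobi

/-! ### Contraction formulas for wedge products and Schouten brackets. -/

section Contraction

variable {A N N₁ N₂ N₃ : Type*} [AddCommGroup A] [Module ℝ A] [AddCommGroup N] [Module ℝ N]
  [AddCommGroup N₁] [Module ℝ N₁] [AddCommGroup N₂] [Module ℝ N₂] [AddCommGroup N₃] [Module ℝ N₃]

/-- The contraction `P(g, ·)` of an alternating map with a vector, as a linear map in `P`. -/
def contract {k : ℕ} (g : A) : (A [⋀^Fin (k + 1)]→ₗ[ℝ] N) →ₗ[ℝ] (A [⋀^Fin k]→ₗ[ℝ] N) where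
  toFun P := P.curryLeft g
  map_add' _ _ := rfl
  map_smul' _ _ := rfl

theorem contract_apply {k : ℕ} (g : A) (P : A [⋀^Fin (k + 1)]→ₗ[ℝ] N) (v : Fin k → A) :
    contract g P v = P (Matrix.vecCons g v) := rfl

theorem contract_add_left {k : ℕ} (f g : A) (P : A [⋀^Fin (k + 1)]→ₗ[ℝ] N) :
    contract (f + g) P = contract f P + contract g P := map_add P.curryLeft f g

theorem contract_self {k : ℕ} (g : A) (P : A [⋀^Fin (k + 2)]→ₗ[ℝ] N) :
    contract g (contract g P) = 0 := P.curryLeft_same g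

theorem contract_contract {k : ℕ} (f g : A) (P : A [⋀^Fin (k + 2)]→ₗ[ℝ] N) :
    contract f (contract g P) = -contract g (contract f P) := by
  have h := contract_self (f + g) P
  simp only [contract_add_left, map_add, contract_self, zero_add, add_zero] at h
  exact eq_neg_of_add_eq_zero_right h

/-- With `ext_elim0` as base case, this drives the inductions on the degree. -/
theorem ext_contract {k : ℕ} {P Q : A [⋀^Fin (k + 1)]→ₗ[ℝ] N}
    (h : ∀ g, contract g P = contract g Q) : P = Q := by
  ext v
  have := congrArg (fun R => R (Matrix.vecTail v)) (h (v 0))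
  simp only [contract_apply] at this
  rwa [show Matrix.vecCons (v 0) (Matrix.vecTail v) = v from Matrix.cons_head_tail v] at this

theorem ext_elim0 {P Q : A [⋀^Fin 0]→ₗ[ℝ] N} (h : P Fin.elim0 = Q Fin.elim0) : P = Q := by
  ext v
  rw [Subsingleton.elim v Fin.elim0, h]

theorem contract_alternatizeUncurryFin_zero (φ : A →ₗ[ℝ] A [⋀^Fin 0]→ₗ[ℝ] N) (g : A) :
    contract g (AlternatingMap.alternatizeUncurryFin φ) = φ g := by
  refine ext_elim0 ?_
  rw [contract_apply, AlternatingMap.alternatizeUncurryFin_apply]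
  simp [Subsingleton.elim _ (Fin.elim0 : Fin 0 → A)]

/-- In the alternating sum, the term feeding the first slot to `φ` gives `φ g`. In the others `g`
stays an argument of `φ`, and the index shift by one flips the sign. -/
theorem contract_alternatizeUncurryFin {k : ℕ} (φ : A →ₗ[ℝ] A [⋀^Fin (k + 1)]→ₗ[ℝ] N) (g : A) :
    contract g (AlternatingMap.alternatizeUncurryFin φ) =
      φ g - AlternatingMap.alternatizeUncurryFin (contract g ∘ₗ φ) := by
  ext v
  rw [contract_apply, AlternatingMap.alternatizeUncurryFin_apply, Fin.sum_univ_succ,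
    AlternatingMap.sub_apply, AlternatingMap.alternatizeUncurryFin_apply, sub_eq_add_neg,
    ← Finset.sum_neg_distrib]
  congr 1
  · simp [Matrix.vecCons]
  · refine Finset.sum_congr rfl fun i _ => ?_
    rw [LinearMap.comp_apply, contract_apply, Matrix.cons_val_succ, Fin.val_succ, pow_succ,
      mul_neg_one, neg_smul]
    congr 3
    ext j
    refine Fin.cases ?_ (fun j => ?_) j <;> simp [Fin.removeNth, Matrix.vecCons]

variable (μ : N₁ →ₗ[ℝ] N₂ →ₗ[ℝ] N₃)

theorem contract_wedge_zero {q : ℕ} (P : A [⋀^Fin 0]→ₗ[ℝ] N₁) (Q : A [⋀^Fin (q + 1)]→ₗ[ℝ] N₂)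
    (g : A) : contract g (wedge μ 0 P Q) = wedge μ 0 P (contract g Q) := rfl

theorem wedge_succ {p q : ℕ} (P : A [⋀^Fin (p + 1)]→ₗ[ℝ] N₁) (Q : A [⋀^Fin q]→ₗ[ℝ] N₂) :
    wedge μ (p + 1) P Q = ((p : ℝ) + 1)⁻¹ •
      AlternatingMap.alternatizeUncurryFin ((wedge μ p).flip Q ∘ₗ P.curryLeft) := rfl

theorem wedge_one {q : ℕ} (P : A [⋀^Fin 1]→ₗ[ℝ] N₁) (Q : A [⋀^Fin q]→ₗ[ℝ] N₂) :
    wedge μ 1 P Q =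
      AlternatingMap.alternatizeUncurryFin ((wedge μ 0).flip Q ∘ₗ P.curryLeft) := by
  rw [wedge_succ]
  simp

theorem contract_wedge_one_zero (P : A [⋀^Fin 1]→ₗ[ℝ] N₁) (Q : A [⋀^Fin 0]→ₗ[ℝ] N₂) (g : A) :
    contract g (wedge μ 1 P Q) = wedge μ 0 (contract g P) Q := by
  rw [wedge_one]
  exact contract_alternatizeUncurryFin_zero _ g

theorem contract_wedge_one {q : ℕ} (P : A [⋀^Fin 1]→ₗ[ℝ] N₁) (Q : A [⋀^Fin (q + 1)]→ₗ[ℝ] N₂)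
    (g : A) : contract g (wedge μ 1 P Q) =
      wedge μ 0 (contract g P) Q - wedge μ 1 P (contract g Q) := by
  rw [wedge_one, wedge_one]
  exact contract_alternatizeUncurryFin _ g

theorem contract_wedge_two_zero (P : A [⋀^Fin 2]→ₗ[ℝ] N₁) (Q : A [⋀^Fin 0]→ₗ[ℝ] N₂) (g : A) :
    contract g (wedge μ 2 P Q) = wedge μ 1 (contract g P) Q := by
  have h : contract g ∘ₗ ((wedge μ 1).flip Q ∘ₗ P.curryLeft) =
      -((wedge μ 0).flip Q ∘ₗ (contract g P).curryLeft) := by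
    refine LinearMap.ext fun f => ?_
    change contract g (wedge μ 1 (contract f P) Q) = -wedge μ 0 (contract f (contract g P)) Q
    rw [contract_wedge_one_zero, contract_contract, map_neg, LinearMap.neg_apply]
  rw [wedge_succ, map_smul]
  refine (congrArg _ (contract_alternatizeUncurryFin _ g)).trans ?_
  rw [h, ← neg_one_smul ℝ, AlternatingMap.alternatizeUncurryFin_smul, ← wedge_one]
  change _ • (wedge μ 1 (contract g P) Q - _) = _
  norm_num
  module

theorem contract_wedge_two {q : ℕ} (P : A [⋀^Fin 2]→ₗ[ℝ] N₁) (Q : A [⋀^Fin (q + 1)]→ₗ[ℝ] N₂)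
    (g : A) : contract g (wedge μ 2 P Q) =
      wedge μ 1 (contract g P) Q + wedge μ 2 P (contract g Q) := by
  have h : contract g ∘ₗ ((wedge μ 1).flip Q ∘ₗ P.curryLeft) =
      (-1 : ℝ) • ((wedge μ 0).flip Q ∘ₗ (contract g P).curryLeft) +
      (-1 : ℝ) • ((wedge μ 1).flip (contract g Q) ∘ₗ P.curryLeft) := by
    refine LinearMap.ext fun f => ?_
    change contract g (wedge μ 1 (contract f P) Q) =
      (-1 : ℝ) • wedge μ 0 (contract f (contract g P)) Q +
      (-1 : ℝ) • wedge μ 1 (contract f P) (contract g Q)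
    rw [contract_wedge_one, contract_contract, map_neg, LinearMap.neg_apply]
    module
  -- `U` is the wedge of `contract g P` with `Q`. It occurs twice, once as the leading term and once
  -- from the contracted sum, which cancels the factor 1/2; the 1/2 left on `V` is the one in `wedge
  -- μ 2`.
  have key (U V : A [⋀^Fin (q + 1 + 1)]→ₗ[ℝ] N₃) :
      (((1 : ℕ) : ℝ) + 1)⁻¹ • (U - ((-1 : ℝ) • U + (-1 : ℝ) • V)) =
        U + (((1 : ℕ) : ℝ) + 1)⁻¹ • V := by
    norm_num
    module
  rw [wedge_succ, map_smul]
  refine (congrArg _ (contract_alternatizeUncurryFin _ g)).trans ?_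
  rw [h, AlternatingMap.alternatizeUncurryFin_add, AlternatingMap.alternatizeUncurryFin_smul,
    AlternatingMap.alternatizeUncurryFin_smul]
  erw [← wedge_one μ (contract g P) Q]
  exact key _ _

theorem contract_flat {p : ℕ} (P : A [⋀^Fin (p + 2)]→ₗ[ℝ] A) (g : A) :
    contract g (flat P) = -flat (contract g P) := by
  ext v f
  exact congrArg (fun R => R v) (contract_contract g f P)

/-- The endomorphism `g ↦ X(g)` given by an alternating map of degree one. -/
def act (X : A [⋀^Fin 1]→ₗ[ℝ] A) : A →ₗ[ℝ] A := flat X Fin.elim0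

theorem contract_elim0 (X : A [⋀^Fin 1]→ₗ[ℝ] A) (g : A) : contract g X Fin.elim0 = act X g := rfl

theorem schouten_vector_succ {q : ℕ} (X : A [⋀^Fin 1]→ₗ[ℝ] A) (P : A [⋀^Fin (q + 1)]→ₗ[ℝ] A) :
    schouten (p := 0) X P =
      wedge LinearMap.id 0 (flat X) P - wedge LinearMap.id.flip 1 X (flat P) := by
  rw [sub_eq_add_neg, ← neg_one_smul ℝ (wedge _ 1 X _), ← pow_one (-1 : ℝ)]
  rfl

theorem schouten_bivector_succ {q : ℕ} (Λ : A [⋀^Fin 2]→ₗ[ℝ] A) (P : A [⋀^Fin (q + 1)]→ₗ[ℝ] A) :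
    schouten (p := 1) Λ P =
      wedge LinearMap.id 1 (flat Λ) P + wedge LinearMap.id.flip 2 Λ (flat P) := by
  rw [← one_smul ℝ (wedge _ 2 Λ _), ← show (-1 : ℝ) ^ 2 = 1 by norm_num]
  rfl

theorem wedge_flip_zero_contract_flat {q : ℕ} (X : A [⋀^Fin 1]→ₗ[ℝ] A)
    (P : A [⋀^Fin (q + 1)]→ₗ[ℝ] A) (g : A) :
    wedge LinearMap.id.flip 0 (contract g X) (flat P) = contract (act X g) P := rfl

/-- This is $i_{dg}\mathcal L_X=\mathcal L_Xi_{dg}-i_{\mathcal L_Xdg}$ with $\mathcal L_Xdg=d(Xg)$.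
-/
theorem contract_schouten_vector {q : ℕ} (X : A [⋀^Fin 1]→ₗ[ℝ] A) (P : A [⋀^Fin (q + 1)]→ₗ[ℝ] A)
    (g : A) : contract g (schouten (p := 0) X P) =
      schouten (p := 0) X (contract g P) - contract (act X g) P := by
  rw [schouten_vector_succ, map_sub]
  cases q with
  | zero =>
    erw [contract_wedge_zero, contract_wedge_one_zero]
    rfl
  | succ q =>
    erw [contract_wedge_zero, contract_wedge_one, contract_flat]
    rw [schouten_vector_succ, wedge_flip_zero_contract_flat, map_neg]
    abel

theorem wedge_zero_flat_contract {q : ℕ} (Λ : A [⋀^Fin 2]→ₗ[ℝ] A) (P : A [⋀^Fin q]→ₗ[ℝ] A)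
    (g : A) : wedge LinearMap.id 0 (contract g (flat Λ)) P =
      -wedge LinearMap.id 0 (flat (contract g Λ)) P := by
  rw [contract_flat, map_neg, LinearMap.neg_apply]

theorem contract_schouten_bivector_zero (Λ : A [⋀^Fin 2]→ₗ[ℝ] A) (P : A [⋀^Fin 0]→ₗ[ℝ] A)
    (g : A) : contract g (schouten (p := 1) Λ P) = -schouten (p := 0) (contract g Λ) P := by
  change contract g (wedge LinearMap.id 1 (flat Λ) P) = _
  rw [contract_wedge_one_zero, wedge_zero_flat_contract]
  rfl

/-- The two halves of the bracket contract separately: the terms with `contract g Λ` assemble into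
the bracket with a vector, the terms with `contract g P` into a bivector bracket of lower degree. -/
theorem contract_schouten_bivector {q : ℕ} (Λ : A [⋀^Fin 2]→ₗ[ℝ] A)
    (P : A [⋀^Fin (q + 1)]→ₗ[ℝ] A) (g : A) : contract g (schouten (p := 1) Λ P) =
      -schouten (p := 0) (contract g Λ) P - schouten (p := 1) Λ (contract g P) := by
  rw [schouten_bivector_succ, schouten_vector_succ, map_add]
  cases q with
  | zero =>
    erw [contract_wedge_one, contract_wedge_two_zero, wedge_zero_flat_contract]
    change _ = _ - wedge LinearMap.id 1 (flat Λ) (contract g P)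
    abel
  | succ q =>
    erw [contract_wedge_one, contract_wedge_two, wedge_zero_flat_contract, contract_flat]
    rw [schouten_bivector_succ, map_neg]
    abel

theorem schouten_add_left {p q : ℕ} (P P' : A [⋀^Fin (p + 1)]→ₗ[ℝ] A) (Q : A [⋀^Fin q]→ₗ[ℝ] A) :
    schouten (P + P') Q = schouten P Q + schouten P' Q := by
  cases q with
  | zero => simp [schouten]
  | succ q =>
    simp only [schouten, map_add, LinearMap.add_apply, LinearMap.smul_apply, LinearMap.comp_apply,
      smul_add]
    abel

end Contraction

/-! ### Leibniz rules over a commutative algebra. -/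

section Multiderivation

variable {A : Type*} [CommRing A] [Algebra ℝ A]

/-- Makes real and function scalars compatible, as `smul_assoc` and `module` require when both
occur. -/
instance instIsScalarTowerAlternatingMap (k : ℕ) : IsScalarTower ℝ A (A [⋀^Fin k]→ₗ[ℝ] A) :=
  ⟨fun r f P => AlternatingMap.ext fun v => smul_assoc r f (P v)⟩

/-- The Schouten-Nijenhuis bracket with an alternating map of degree one. -/
def lie (X : A [⋀^Fin 1]→ₗ[ℝ] A) {k : ℕ} : (A [⋀^Fin k]→ₗ[ℝ] A) →ₗ[ℝ] (A [⋀^Fin k]→ₗ[ℝ] A) :=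
  schouten (p := 0) X

/-- The Schouten-Nijenhuis bracket with an alternating map of degree two. -/
def bracket (Λ : A [⋀^Fin 2]→ₗ[ℝ] A) {k : ℕ} :
    (A [⋀^Fin k]→ₗ[ℝ] A) →ₗ[ℝ] (A [⋀^Fin (k + 1)]→ₗ[ℝ] A) :=
  schouten (p := 1) Λ

/-- The exterior product with an alternating map of degree one. -/
def wedgeVec {k : ℕ} (X : A [⋀^Fin 1]→ₗ[ℝ] A) :
    (A [⋀^Fin k]→ₗ[ℝ] A) →ₗ[ℝ] (A [⋀^Fin (k + 1)]→ₗ[ℝ] A) :=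
  wedge (LinearMap.mul ℝ A) 1 X

/-- The exterior product with an alternating map of degree two. -/
def wedgeBiv {k : ℕ} (Λ : A [⋀^Fin 2]→ₗ[ℝ] A) :
    (A [⋀^Fin k]→ₗ[ℝ] A) →ₗ[ℝ] (A [⋀^Fin (k + 2)]→ₗ[ℝ] A) :=
  wedge (LinearMap.mul ℝ A) 2 Λ

theorem contract_smul {k : ℕ} (f g : A) (P : A [⋀^Fin (k + 1)]→ₗ[ℝ] A) :
    contract g (f • P) = f • contract g P := rfl

theorem act_smul_left (f g : A) (X : A [⋀^Fin 1]→ₗ[ℝ] A) : act (f • X) g = f * act X g := rfl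

theorem act_contract_swap (Λ : A [⋀^Fin 2]→ₗ[ℝ] A) (f g : A) :
    act (contract f Λ) g = -act (contract g Λ) f :=
  congrArg (fun F => F Fin.elim0) (contract_contract g f Λ)

theorem act_contract_self (Λ : A [⋀^Fin 2]→ₗ[ℝ] A) (f : A) : act (contract f Λ) f = 0 :=
  congrArg (fun F => F Fin.elim0) (contract_self f Λ)

theorem smul_elim0 (f : A) (F : A [⋀^Fin 0]→ₗ[ℝ] A) : (f • F) Fin.elim0 = f * F Fin.elim0 := rfl

theorem contract_wedgeVec_zero (X : A [⋀^Fin 1]→ₗ[ℝ] A) (F : A [⋀^Fin 0]→ₗ[ℝ] A) (g : A) :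
    contract g (wedgeVec X F) = act X g • F :=
  contract_wedge_one_zero _ X F g

theorem contract_wedgeVec {k : ℕ} (X : A [⋀^Fin 1]→ₗ[ℝ] A) (P : A [⋀^Fin (k + 1)]→ₗ[ℝ] A) (g : A) :
    contract g (wedgeVec X P) = act X g • P - wedgeVec X (contract g P) :=
  contract_wedge_one _ X P g

theorem contract_wedgeBiv_zero (Λ : A [⋀^Fin 2]→ₗ[ℝ] A) (F : A [⋀^Fin 0]→ₗ[ℝ] A) (g : A) :
    contract g (wedgeBiv Λ F) = wedgeVec (contract g Λ) F :=
  contract_wedge_two_zero _ Λ F g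

theorem contract_wedgeBiv {k : ℕ} (Λ : A [⋀^Fin 2]→ₗ[ℝ] A) (P : A [⋀^Fin (k + 1)]→ₗ[ℝ] A) (g : A) :
    contract g (wedgeBiv Λ P) = wedgeVec (contract g Λ) P + wedgeBiv Λ (contract g P) :=
  contract_wedge_two _ Λ P g

/-- Since $i_g^2=0$, one formula covers all degrees, including the case where `contract g P` is a
function and cannot be contracted again. -/
theorem contract_wedgeBiv_contract {k : ℕ} (Λ : A [⋀^Fin 2]→ₗ[ℝ] A) (P : A [⋀^Fin (k + 1)]→ₗ[ℝ] A)
    (g : A) : contract g (wedgeBiv Λ (contract g P)) = wedgeVec (contract g Λ) (contract g P) := by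
  cases k with
  | zero => exact contract_wedgeBiv_zero _ _ _
  | succ k => rw [contract_wedgeBiv, contract_self, map_zero, add_zero]

theorem lie_elim0 (X : A [⋀^Fin 1]→ₗ[ℝ] A) (F : A [⋀^Fin 0]→ₗ[ℝ] A) :
    lie X F Fin.elim0 = act X (F Fin.elim0) := rfl

theorem contract_lie {k : ℕ} (X : A [⋀^Fin 1]→ₗ[ℝ] A) (P : A [⋀^Fin (k + 1)]→ₗ[ℝ] A) (g : A) :
    contract g (lie X P) = lie X (contract g P) - contract (act X g) P :=
  contract_schouten_vector X P g

theorem contract_bracket_zero (Λ : A [⋀^Fin 2]→ₗ[ℝ] A) (F : A [⋀^Fin 0]→ₗ[ℝ] A) (g : A) :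
    contract g (bracket Λ F) = -lie (contract g Λ) F :=
  contract_schouten_bivector_zero Λ F g

theorem contract_bracket {k : ℕ} (Λ : A [⋀^Fin 2]→ₗ[ℝ] A) (P : A [⋀^Fin (k + 1)]→ₗ[ℝ] A) (g : A) :
    contract g (bracket Λ P) = -lie (contract g Λ) P - bracket Λ (contract g P) :=
  contract_schouten_bivector Λ P g

theorem lie_add_left {k : ℕ} (X Y : A [⋀^Fin 1]→ₗ[ℝ] A) (P : A [⋀^Fin k]→ₗ[ℝ] A) :
    lie (X + Y) P = lie X P + lie Y P := schouten_add_left X Y P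

theorem wedge_mul_smul_left (f : A) {p q : ℕ} (P : A [⋀^Fin p]→ₗ[ℝ] A) (Q : A [⋀^Fin q]→ₗ[ℝ] A) :
    wedge (LinearMap.mul ℝ A) p (f • P) Q = f • wedge (LinearMap.mul ℝ A) p P Q := by
  induction p with
  | zero =>
    ext v
    exact mul_assoc _ _ _
  | succ p ih =>
    have h : (wedge (LinearMap.mul ℝ A) p).flip Q ∘ₗ (f • P).curryLeft =
        f • ((wedge (LinearMap.mul ℝ A) p).flip Q ∘ₗ P.curryLeft) :=
      LinearMap.ext fun g => ih (P.curryLeft g)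
    rw [wedge_succ, wedge_succ, h, AlternatingMap.alternatizeUncurryFin_smul]
    exact smul_comm _ _ _

theorem wedge_mul_smul_right (f : A) {p q : ℕ} (P : A [⋀^Fin p]→ₗ[ℝ] A) (Q : A [⋀^Fin q]→ₗ[ℝ] A) :
    wedge (LinearMap.mul ℝ A) p P (f • Q) = f • wedge (LinearMap.mul ℝ A) p P Q := by
  induction p with
  | zero =>
    ext v
    exact mul_left_comm _ _ _
  | succ p ih =>
    have h : (wedge (LinearMap.mul ℝ A) p).flip (f • Q) ∘ₗ P.curryLeft =
        f • ((wedge (LinearMap.mul ℝ A) p).flip Q ∘ₗ P.curryLeft) :=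
      LinearMap.ext fun g => ih (P.curryLeft g)
    rw [wedge_succ, wedge_succ, h, AlternatingMap.alternatizeUncurryFin_smul]
    exact smul_comm _ _ _

theorem wedgeVec_smul_left {k : ℕ} (f : A) (X : A [⋀^Fin 1]→ₗ[ℝ] A) (P : A [⋀^Fin k]→ₗ[ℝ] A) :
    wedgeVec (f • X) P = f • wedgeVec X P := wedge_mul_smul_left f X P

theorem wedgeVec_smul {k : ℕ} (f : A) (X : A [⋀^Fin 1]→ₗ[ℝ] A) (P : A [⋀^Fin k]→ₗ[ℝ] A) :
    wedgeVec X (f • P) = f • wedgeVec X P := wedge_mul_smul_right f X P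

theorem wedgeVec_add_left {k : ℕ} (X Y : A [⋀^Fin 1]→ₗ[ℝ] A) (P : A [⋀^Fin k]→ₗ[ℝ] A) :
    wedgeVec (X + Y) P = wedgeVec X P + wedgeVec Y P :=
  LinearMap.map_add₂ (wedge (LinearMap.mul ℝ A) 1) X Y P

theorem wedgeBiv_smul_left {k : ℕ} (f : A) (Λ : A [⋀^Fin 2]→ₗ[ℝ] A) (P : A [⋀^Fin k]→ₗ[ℝ] A) :
    wedgeBiv (f • Λ) P = f • wedgeBiv Λ P := wedge_mul_smul_left f Λ P

theorem wedgeBiv_smul {k : ℕ} (f : A) (Λ : A [⋀^Fin 2]→ₗ[ℝ] A) (P : A [⋀^Fin k]→ₗ[ℝ] A) :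
    wedgeBiv Λ (f • P) = f • wedgeBiv Λ P := wedge_mul_smul_right f Λ P

/-- An alternating map is a multiderivation if it is a derivation in its first argument, hence in
each of them. There is no condition in degree zero. -/
def IsMultiderivation : {k : ℕ} → (A [⋀^Fin k]→ₗ[ℝ] A) → Prop
  | 0, _ => True
  | _ + 1, P => ∀ f g, contract (f * g) P = f • contract g P + g • contract f P

theorem IsMultiderivation.contract {k : ℕ} {P : A [⋀^Fin (k + 1)]→ₗ[ℝ] A}
    (hP : IsMultiderivation P) (h : A) : IsMultiderivation (contract h P) := by
  cases k with
  | zero => trivial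
  | succ k =>
    intro f g
    have := hP f g
    rw [contract_contract, this, map_add, contract_smul, contract_smul, contract_contract f h,
      contract_contract g h]
    module

theorem IsMultiderivation.smul {k : ℕ} {P : A [⋀^Fin k]→ₗ[ℝ] A}
    (hP : IsMultiderivation P) (h : A) : IsMultiderivation (h • P) := by
  cases k with
  | zero => trivial
  | succ k =>
    intro f g
    have := hP f g
    rw [contract_smul, contract_smul, contract_smul, this]
    module

theorem IsMultiderivation.act_mul {X : A [⋀^Fin 1]→ₗ[ℝ] A} (hX : IsMultiderivation X) (f g : A) :
    act X (f * g) = f * act X g + g * act X f :=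
  congrArg (fun F => F Fin.elim0) (hX f g)

/-- The rule $d(a^m)=m\,a^{m-1}da$, multiplied by `a` so that no exponent `m - 1` appears. -/
theorem IsMultiderivation.smul_contract_pow {k : ℕ} {P : A [⋀^Fin (k + 1)]→ₗ[ℝ] A}
    (hP : IsMultiderivation P) (a : A) (m : ℕ) :
    a • LichnerowiczJacobi.contract (a ^ m) P =
      (m : ℝ) • a ^ m • LichnerowiczJacobi.contract a P := by
  induction m with
  | zero =>
    -- A derivation kills constants, by the Leibniz rule for `1 * 1`.
    have h := hP 1 1
    simp only [one_mul, one_smul] at h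
    simp [left_eq_add.mp h]
  | succ m ih =>
    have h := hP (a ^ m) a
    rw [pow_succ, h, smul_add, ih, Nat.cast_add, Nat.cast_one]
    module

theorem IsMultiderivation.mul_act_pow {X : A [⋀^Fin 1]→ₗ[ℝ] A} (hX : IsMultiderivation X)
    (a : A) (m : ℕ) : a * act X (a ^ m) = (m : ℝ) • (a ^ m * act X a) :=
  congrArg (fun F => F Fin.elim0) (hX.smul_contract_pow a m)

theorem IsMultiderivation.act_pow_eq_zero {X : A [⋀^Fin 1]→ₗ[ℝ] A} (hX : IsMultiderivation X)
    {a : A} (ha : act X a = 0) (m : ℕ) : act X (a ^ (m + 1)) = 0 := by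
  induction m with
  | zero => rw [zero_add, pow_one, ha]
  | succ m ih => rw [pow_succ, hX.act_mul, ih, ha, mul_zero, mul_zero, add_zero]

theorem lie_smul {k : ℕ} {X : A [⋀^Fin 1]→ₗ[ℝ] A} (hX : IsMultiderivation X) (h : A)
    (P : A [⋀^Fin k]→ₗ[ℝ] A) : lie X (h • P) = act X h • P + h • lie X P := by
  induction k with
  | zero =>
    refine ext_elim0 ?_
    rw [AlternatingMap.add_apply, lie_elim0, smul_elim0, smul_elim0, smul_elim0, lie_elim0,
      hX.act_mul]
    ring
  | succ k ih =>
    refine ext_contract fun g => ?_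
    rw [map_add, contract_lie, contract_smul, ih, contract_smul, contract_smul, contract_smul,
      contract_lie]
    module

theorem lie_smul_left_zero (X : A [⋀^Fin 1]→ₗ[ℝ] A) (h : A) (F : A [⋀^Fin 0]→ₗ[ℝ] A) :
    lie (h • X) F = h • lie X F := rfl

/-- The correction term comes from contracting `P` with the product `h * act X g`, which the
derivation property of `P` splits. -/
theorem lie_smul_left_succ {k : ℕ} (X : A [⋀^Fin 1]→ₗ[ℝ] A) (h : A)
    {P : A [⋀^Fin (k + 1)]→ₗ[ℝ] A} (hP : IsMultiderivation P) :
    lie (h • X) P = h • lie X P - wedgeVec X (contract h P) := by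
  induction k with
  | zero =>
    refine ext_contract fun g => ?_
    have := hP h (act X g)
    rw [map_sub, contract_lie, contract_smul, contract_lie, contract_wedgeVec_zero, act_smul_left,
      lie_smul_left_zero, this]
    module
  | succ k ih =>
    refine ext_contract fun g => ?_
    have := hP h (act X g)
    rw [map_sub, contract_lie, contract_smul, contract_lie, contract_wedgeVec, act_smul_left,
      ih (hP.contract g), this, contract_contract h g, map_neg]
    module

theorem bracket_smul {k : ℕ} {Λ : A [⋀^Fin 2]→ₗ[ℝ] A} (hΛ : IsMultiderivation Λ) (h : A)
    (P : A [⋀^Fin k]→ₗ[ℝ] A) :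
    bracket Λ (h • P) = h • bracket Λ P + wedgeVec (contract h Λ) P := by
  induction k with
  | zero =>
    refine ext_contract fun g => ?_
    rw [map_add, contract_smul, contract_bracket_zero, contract_bracket_zero,
      contract_wedgeVec_zero, lie_smul (hΛ.contract g), act_contract_swap Λ h g]
    module
  | succ k ih =>
    refine ext_contract fun g => ?_
    rw [map_add, contract_smul, contract_bracket, contract_bracket,
      contract_wedgeVec, lie_smul (hΛ.contract g), act_contract_swap Λ h g, contract_smul, ih]
    module

theorem bracket_smul_left_zero (Λ : A [⋀^Fin 2]→ₗ[ℝ] A) (h : A) (F : A [⋀^Fin 0]→ₗ[ℝ] A) :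
    bracket (h • Λ) F = h • bracket Λ F := by
  refine ext_contract fun g => ?_
  rw [contract_smul, contract_bracket_zero, contract_bracket_zero, contract_smul,
    lie_smul_left_zero, smul_neg]

theorem bracket_smul_left_succ {k : ℕ} (Λ : A [⋀^Fin 2]→ₗ[ℝ] A) (h : A)
    {P : A [⋀^Fin (k + 1)]→ₗ[ℝ] A} (hP : IsMultiderivation P) :
    bracket (h • Λ) P = h • bracket Λ P + wedgeBiv Λ (contract h P) := by
  induction k with
  | zero =>
    refine ext_contract fun g => ?_
    rw [map_add, contract_smul, contract_bracket, contract_bracket, contract_wedgeBiv_zero,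
      contract_smul, lie_smul_left_succ _ _ hP, bracket_smul_left_zero]
    module
  | succ k ih =>
    refine ext_contract fun g => ?_
    rw [map_add, contract_smul, contract_bracket, contract_bracket, contract_wedgeBiv,
      contract_smul, lie_smul_left_succ _ _ hP, ih (hP.contract g), contract_contract h g, map_neg]
    module

/-- The parenthesis is $\Lambda\wedge i_{dh}P$ in positive degree and zero in degree zero. Written
this way it makes sense in every degree, which spares later case distinctions. -/
theorem bracket_smul_left {k : ℕ} (Λ : A [⋀^Fin 2]→ₗ[ℝ] A) (h : A)
    {P : A [⋀^Fin k]→ₗ[ℝ] A} (hP : IsMultiderivation P) :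
    bracket (h • Λ) P =
      h • bracket Λ P + (contract h (wedgeBiv Λ P) - wedgeVec (contract h Λ) P) := by
  cases k with
  | zero => rw [contract_wedgeBiv_zero, bracket_smul_left_zero, sub_self, add_zero]
  | succ k => rw [contract_wedgeBiv, bracket_smul_left_succ Λ h hP, add_sub_cancel_left]

/-! ### Conformal changes -/

/-- In the coefficient `m - 1`, the `m` comes from differentiating `a ^ m` and the `-1` from
`bracket_smul_left`. -/
theorem bracket_smul_pow_smul {k : ℕ} {Λ : A [⋀^Fin 2]→ₗ[ℝ] A} (hΛ : IsMultiderivation Λ) (a : A)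
    (m : ℕ) {R : A [⋀^Fin k]→ₗ[ℝ] A} (hR : IsMultiderivation R) :
    bracket (a • Λ) (a ^ m • R) = a ^ (m + 1) • bracket Λ R +
      ((m : ℝ) - 1) • a ^ m • wedgeVec (contract a Λ) R + a ^ m • contract a (wedgeBiv Λ R) := by
  rw [bracket_smul_left Λ a (hR.smul _), bracket_smul hΛ, smul_add, ← wedgeVec_smul_left a,
    hΛ.smul_contract_pow, wedgeBiv_smul, contract_smul, wedgeVec_smul,
    show wedgeVec ((m : ℝ) • a ^ m • contract a Λ) R =
      (m : ℝ) • a ^ m • wedgeVec (contract a Λ) R by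
      rw [← wedgeVec_smul_left]
      exact LinearMap.map_smul₂ (wedge (LinearMap.mul ℝ A) 1) _ _ _]
  module

theorem lie_smul_pow_smul {k : ℕ} {E : A [⋀^Fin 1]→ₗ[ℝ] A} (hE : IsMultiderivation E) (a : A)
    (m : ℕ) {P : A [⋀^Fin (k + 1)]→ₗ[ℝ] A} (hP : IsMultiderivation P) :
    lie (a • E) (a ^ m • P) = a ^ (m + 1) • lie E P + (m : ℝ) • (a ^ m * act E a) • P -
      a ^ m • wedgeVec E (contract a P) := by
  rw [lie_smul_left_succ E a (hP.smul _), lie_smul hE, smul_add, smul_smul, hE.mul_act_pow,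
    smul_assoc, contract_smul, wedgeVec_smul]
  module

/-- With `m = k + 1`, the bracket yields the error terms $(k+1)a^{k+1}\#da\wedge P$ and
$a^{k+1}\Lambda\wedge i_{da}P$. The first is cancelled by the part $\#da$ of the new vector field,
the second by the correction $a^ki_{da}P$ in the second component. -/
theorem conformal_fst {k : ℕ} {Λ : A [⋀^Fin 2]→ₗ[ℝ] A} (hΛ : IsMultiderivation Λ)
    (E : A [⋀^Fin 1]→ₗ[ℝ] A) (a : A) {P : A [⋀^Fin (k + 1)]→ₗ[ℝ] A} (hP : IsMultiderivation P)
    (Q : A [⋀^Fin k]→ₗ[ℝ] A) :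
    -bracket (a • Λ) (a ^ (k + 1) • P)
        + ((k : ℝ) + 1) • wedgeVec (contract a Λ + a • E) (a ^ (k + 1) • P)
        + wedgeBiv (a • Λ) (a ^ (k + 1) • Q + a ^ k • contract a P) =
      a ^ (k + 2) • (-bracket Λ P + ((k : ℝ) + 1) • wedgeVec E P + wedgeBiv Λ Q) := by
  rw [bracket_smul_pow_smul hΛ a _ hP, contract_wedgeBiv, wedgeVec_add_left, wedgeVec_smul_left,
    wedgeVec_smul, wedgeVec_smul, wedgeBiv_smul_left, map_add, wedgeBiv_smul, wedgeBiv_smul,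
    Nat.cast_add, Nat.cast_one]
  module

/-- The last summand is the correction term of `rescale` applied to the first component of
$\sigma(P,Q)$. Its contraction of $[\Lambda,P]$ supplies $\mathcal L_{\#da}P$; the remaining terms
cancel by $i_{da}^2=0$ and $(\#da)(a)=\Lambda(da,da)=0$. -/
theorem conformal_snd {k : ℕ} {Λ : A [⋀^Fin 2]→ₗ[ℝ] A} (hΛ : IsMultiderivation Λ)
    {E : A [⋀^Fin 1]→ₗ[ℝ] A} (hE : IsMultiderivation E) (a : A) {P : A [⋀^Fin (k + 1)]→ₗ[ℝ] A}
    (hP : IsMultiderivation P) {Q : A [⋀^Fin k]→ₗ[ℝ] A} (hQ : IsMultiderivation Q) :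
    bracket (a • Λ) (a ^ (k + 1) • Q + a ^ k • contract a P)
        - (k : ℝ) • wedgeVec (contract a Λ + a • E) (a ^ (k + 1) • Q + a ^ k • contract a P)
        + lie (contract a Λ + a • E) (a ^ (k + 1) • P) =
      a ^ (k + 2) • (bracket Λ Q - (k : ℝ) • wedgeVec E Q + lie E P) +
        a ^ (k + 1) •
          contract a (-bracket Λ P + ((k : ℝ) + 1) • wedgeVec E P + wedgeBiv Λ Q) := by
  rw [map_add, bracket_smul_pow_smul hΛ a _ hQ, bracket_smul_pow_smul hΛ a _ (hP.contract a),
    contract_wedgeBiv_contract, wedgeVec_add_left, wedgeVec_smul_left, map_add, map_add,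
    wedgeVec_smul, wedgeVec_smul, wedgeVec_smul, wedgeVec_smul, lie_add_left,
    lie_smul (hΛ.contract a), (hΛ.contract a).act_pow_eq_zero (act_contract_self Λ a),
    lie_smul_pow_smul hE a _ hP, map_add, map_add, map_neg, map_smul, contract_bracket,
    contract_wedgeVec, Nat.cast_add, Nat.cast_one]
  module

theorem conformal_snd_zero (Λ : A [⋀^Fin 2]→ₗ[ℝ] A) (E : A [⋀^Fin 1]→ₗ[ℝ] A) (a : A)
    (F : A [⋀^Fin 0]→ₗ[ℝ] A) :
    lie (contract a Λ + a • E) F = a • lie E F + contract a (-bracket Λ F) := by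
  rw [lie_add_left, lie_smul_left_zero, map_neg, contract_bracket_zero, neg_neg, add_comm]

/-! ### The conformal change is again a Jacobi structure. -/

theorem lie_swap (X Y : A [⋀^Fin 1]→ₗ[ℝ] A) : lie X Y = -lie Y X := by
  refine ext_contract fun g => ?_
  rw [map_neg, contract_lie, contract_lie]
  refine ext_elim0 ?_
  change act X (act Y g) - act Y (act X g) = -(act Y (act X g) - act X (act Y g))
  abel

theorem bracket_vector (Λ : A [⋀^Fin 2]→ₗ[ℝ] A) (X : A [⋀^Fin 1]→ₗ[ℝ] A) :
    bracket Λ X = lie X Λ := by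
  refine ext_contract fun g => ?_
  have h : bracket Λ (contract g X) = contract (act X g) Λ := by
    refine ext_contract fun f => ?_
    rw [contract_bracket_zero, contract_contract]
    exact congrArg Neg.neg (ext_elim0 rfl)
  rw [contract_bracket, contract_lie, lie_swap X, h]

theorem wedgeVec_function (X : A [⋀^Fin 1]→ₗ[ℝ] A) (F : A [⋀^Fin 0]→ₗ[ℝ] A) :
    wedgeVec X F = F Fin.elim0 • X := by
  refine ext_contract fun g => ?_
  rw [contract_wedgeVec_zero]
  exact ext_elim0 (mul_comm _ _)

theorem wedgeBiv_function (Λ : A [⋀^Fin 2]→ₗ[ℝ] A) (F : A [⋀^Fin 0]→ₗ[ℝ] A) :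
    wedgeBiv Λ F = F Fin.elim0 • Λ := by
  refine ext_contract fun g => ?_
  rw [contract_wedgeBiv_zero, wedgeVec_function]
  rfl

theorem wedgeVec_swap (X Y : A [⋀^Fin 1]→ₗ[ℝ] A) : wedgeVec X Y = -wedgeVec Y X := by
  refine ext_contract fun g => ?_
  rw [map_neg, contract_wedgeVec, contract_wedgeVec, wedgeVec_function, wedgeVec_function,
    contract_elim0, contract_elim0]
  module

theorem wedgeBiv_vector (Λ : A [⋀^Fin 2]→ₗ[ℝ] A) (X : A [⋀^Fin 1]→ₗ[ℝ] A) :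
    wedgeBiv Λ X = wedgeVec X Λ := by
  refine ext_contract fun g => ?_
  rw [contract_wedgeBiv, contract_wedgeVec, wedgeVec_swap, wedgeBiv_function, contract_elim0]
  module

theorem conformal_bracket_self {Λ : A [⋀^Fin 2]→ₗ[ℝ] A} (hΛ : IsMultiderivation Λ)
    {E : A [⋀^Fin 1]→ₗ[ℝ] A} (h : bracket Λ Λ = (2 : ℝ) • wedgeVec E Λ) (a : A) :
    bracket (a • Λ) (a • Λ) = (2 : ℝ) • wedgeVec (contract a Λ + a • E) (a • Λ) := by
  rw [bracket_smul_left_succ Λ a (hΛ.smul a), bracket_smul hΛ, contract_smul, wedgeBiv_smul,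
    wedgeBiv_vector, h, wedgeVec_smul, wedgeVec_add_left, wedgeVec_smul_left, two_smul, two_smul]
  module

theorem conformal_lie_self {Λ : A [⋀^Fin 2]→ₗ[ℝ] A} (hΛ : IsMultiderivation Λ)
    {E : A [⋀^Fin 1]→ₗ[ℝ] A} (hE : IsMultiderivation E)
    (h : bracket Λ Λ = (2 : ℝ) • wedgeVec E Λ) (h' : lie E Λ = 0) (a : A) :
    lie (contract a Λ + a • E) (a • Λ) = 0 := by
  -- Contracting $[\Lambda,\Lambda]=2E\wedge\Lambda$ with $da$ gives $-2\mathcal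
  -- L_{\#da}\Lambda=2\bigl(E(a)\Lambda-E\wedge\#da\bigr)$.
  have key : lie (contract a Λ) Λ = wedgeVec E (contract a Λ) - act E a • Λ := by
    have h2 := congrArg (contract a) h
    rw [contract_bracket, bracket_vector, map_smul, contract_wedgeVec] at h2
    refine smul_right_injective _ (two_ne_zero' ℝ) ?_
    change (2 : ℝ) • _ = (2 : ℝ) • _
    rw [two_smul] at h2 ⊢
    rw [two_smul]
    linear_combination (norm := module) (-1 : ℝ) • h2
  rw [lie_add_left, lie_smul (hΛ.contract a), act_contract_self, key,
    lie_smul_left_succ E a (hΛ.smul a), lie_smul hE, h', contract_smul, wedgeVec_smul]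
  module

end Multiderivation

/-! ### Multivector fields on the manifold and the isomorphism of complexes. -/

section Manifold

universe u

variable {n : ℕ} {M : Type u} [TopologicalSpace M] [ChartedSpace (EuclideanSpace ℝ (Fin n)) M]

theorem differential_mul (f g : SmoothFun n M) (x : M) :
    differential (f * g) x = f x • differential g x + g x • differential f x := by
  have hf : HasMFDerivAt (𝓡 n) 𝓘(ℝ, ℝ) f x (differential f x) :=
    (f.contMDiff.mdifferentiable (by simp) x).hasMFDerivAt
  have hg : HasMFDerivAt (𝓡 n) 𝓘(ℝ, ℝ) g x (differential g x) :=
    (g.contMDiff.mdifferentiable (by simp) x).hasMFDerivAt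
  exact (hf.mul hg).mfderiv

/-- A multivector field sees a function only through its differential, pointwise and linearly, so it
inherits the Leibniz rule of $d$. -/
theorem isMultiderivation_of_mem {k : ℕ} {P : Alt n M k} (hP : P ∈ multivectorFields n M k) :
    IsMultiderivation P := by
  cases k with
  | zero => trivial
  | succ k =>
    obtain ⟨T, hT⟩ := hP
    intro f g
    ext v x
    have key (h : SmoothFun n M) : contract h P v x =
        (T x).curryLeft (differential h x) (fun i => differential (v i) x) := by
      refine (hT _ x).trans (congrArg (T x) ?_)
      funext i
      refine Fin.cases ?_ (fun i => ?_) i <;> rfl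
    change contract (f * g) P v x = f x * contract g P v x + g x * contract f P v x
    rw [key, key, key, differential_mul, map_add, map_smul, map_smul]
    rfl

theorem smul_mem_multivectorFields {k : ℕ} {P : Alt n M k} (hP : P ∈ multivectorFields n M k)
    (a : SmoothFun n M) : a • P ∈ multivectorFields n M k := by
  obtain ⟨T, hT⟩ := hP
  exact ⟨fun x => a x • T x, fun f x => congrArg (a x * ·) (hT f x)⟩

theorem contract_mem_multivectorFields {k : ℕ} {P : Alt n M (k + 1)}
    (hP : P ∈ multivectorFields n M (k + 1)) (a : SmoothFun n M) :
    contract a P ∈ multivectorFields n M k := by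
  obtain ⟨T, hT⟩ := hP
  refine ⟨fun x => (T x).curryLeft (differential a x), fun f x => ?_⟩
  refine (hT _ x).trans (congrArg (T x) ?_)
  funext i
  refine Fin.cases ?_ (fun i => ?_) i <;> rfl

theorem IsJacobi.conformal {Λ : Alt n M 2} {E : Alt n M 1} (hJ : IsJacobi Λ E)
    (a : SmoothFun n M) : IsJacobi (conformalBivector Λ a) (conformalVector Λ E a) where
  bivector := smul_mem_multivectorFields hJ.bivector a
  vector := add_mem (contract_mem_multivectorFields hJ.bivector a)
    (smul_mem_multivectorFields hJ.vector a)
  schouten_self := conformal_bracket_self (isMultiderivation_of_mem hJ.bivector) hJ.schouten_self a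
  schouten_vector := conformal_lie_self (isMultiderivation_of_mem hJ.bivector)
    (isMultiderivation_of_mem hJ.vector) hJ.schouten_self hJ.schouten_vector a

/-- The map `(P, Q) ↦ (aᵏ⁺¹ P, aᵏ⁺¹ Q + aᵏ i_{da} P)` in degree `k + 1`, where `a b = 1`. -/
def rescaleSucc (a b : SmoothFun n M) (hab : a * b = 1) (k : ℕ) :
    (Alt n M (k + 1) × Alt n M k) ≃ₗ[ℝ] (Alt n M (k + 1) × Alt n M k) where
  toFun c := (a ^ (k + 1) • c.1, a ^ (k + 1) • c.2 + a ^ k • contract a c.1)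
  map_add' c d := by
    refine Prod.ext (smul_add _ _ _) ?_
    simp only [Prod.fst_add, Prod.snd_add, map_add]
    module
  map_smul' r c := by
    refine Prod.ext (smul_comm _ _ _) ?_
    simp only [Prod.smul_fst, Prod.smul_snd, map_smul, RingHom.id_apply]
    module
  -- Solving for the second component gives the coefficient $b^{k+1}a^kb^{k+1}=b^{k+2}$.
  invFun c := (b ^ (k + 1) • c.1, b ^ (k + 1) • c.2 - b ^ (k + 2) • contract a c.1)
  left_inv c := by
    have h (m : ℕ) : b ^ m * a ^ m = 1 := by rw [← mul_pow, mul_comm, hab, one_pow]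
    have h' : b ^ (k + 2) * a ^ (k + 1) = b ^ (k + 1) * a ^ k := by
      linear_combination b * h (k + 1) - b * h k
    refine Prod.ext ?_ ?_
    · simp only [smul_smul, h, one_smul]
    · simp only [contract_smul, smul_add, smul_smul, h, h', one_smul, add_sub_cancel_right]
  right_inv c := by
    have h (m : ℕ) : a ^ m * b ^ m = 1 := by rw [← mul_pow, hab, one_pow]
    have h' : a ^ (k + 1) * b ^ (k + 2) = a ^ k * b ^ (k + 1) := by
      linear_combination b * h (k + 1) - b * h k
    refine Prod.ext ?_ ?_
    · simp only [smul_smul, h, one_smul]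
    · simp only [contract_smul, smul_sub, smul_smul, h, h', one_smul, sub_add_cancel]

/-- The isomorphism of graded spaces which intertwines the Lichnerowicz-Jacobi operators of a Jacobi
structure and of its conformal change by `a`, where `a b = 1`. -/
def rescale (a b : SmoothFun n M) (hab : a * b = 1) : (k : ℕ) →
    (Alt n M k × LowerAlt n M k) ≃ₗ[ℝ] (Alt n M k × LowerAlt n M k)
  | 0 => LinearEquiv.refl ℝ _
  | k + 1 => rescaleSucc a b hab k

/-- The equivalence lives on all alternating maps. Both it and its inverse use only contraction with
`a` and multiplication by functions, which preserve multivector fields. -/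
theorem map_rescale_cochains (a b : SmoothFun n M) (hab : a * b = 1) (k : ℕ) :
    (cochains n M k).map (rescale a b hab k).toLinearMap = cochains n M k := by
  cases k with
  | zero => exact Submodule.map_id _
  | succ k =>
    refine le_antisymm ?_ fun c hc => ?_
    · rintro _ ⟨c, hc, rfl⟩
      exact ⟨smul_mem_multivectorFields hc.1 _, add_mem (smul_mem_multivectorFields hc.2 _)
        (smul_mem_multivectorFields (contract_mem_multivectorFields hc.1 a) _)⟩
    · refine ⟨(rescaleSucc a b hab k).symm c, ?_, (rescaleSucc a b hab k).apply_symm_apply c⟩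
      exact ⟨smul_mem_multivectorFields hc.1 _, sub_mem (smul_mem_multivectorFields hc.2 _)
        (smul_mem_multivectorFields (contract_mem_multivectorFields hc.1 a) _)⟩

/-- Restricted to cochains because the Leibniz rules need multiderivations. Degree zero is separate,
having no second component and no correction term. -/
theorem sigma_rescale {Λ : Alt n M 2} {E : Alt n M 1} (hΛ : Λ ∈ multivectorFields n M 2)
    (hE : E ∈ multivectorFields n M 1) (a b : SmoothFun n M) (hab : a * b = 1) (k : ℕ)
    {c : Alt n M k × LowerAlt n M k} (hc : c ∈ cochains n M k) :
    sigma (conformalBivector Λ a) (conformalVector Λ E a) k (rescale a b hab k c) =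
      rescale a b hab (k + 1) (sigma Λ E k c) := by
  cases k with
  | zero =>
    refine Prod.ext ?_ ?_
    · change -bracket (a • Λ) c.1 = a ^ 1 • (-bracket Λ c.1)
      rw [bracket_smul_left_zero, pow_one, smul_neg]
    · change lie (contract a Λ + a • E) c.1 =
        a ^ 1 • lie E c.1 + a ^ 0 • contract a (-bracket Λ c.1)
      rw [conformal_snd_zero, pow_one, pow_zero, one_smul]
  | succ k =>
    refine Prod.ext ?_ ?_
    · exact conformal_fst (isMultiderivation_of_mem hΛ) E a (isMultiderivation_of_mem hc.1) c.2
    · exact conformal_snd (isMultiderivation_of_mem hΛ) (isMultiderivation_of_mem hE) a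
        (isMultiderivation_of_mem hc.1) (isMultiderivation_of_mem hc.2)

theorem map_rescale_cocycles {Λ : Alt n M 2} {E : Alt n M 1} (hΛ : Λ ∈ multivectorFields n M 2)
    (hE : E ∈ multivectorFields n M 1) (a b : SmoothFun n M) (hab : a * b = 1) (k : ℕ) :
    (cocycles Λ E k).map (rescale a b hab k).toLinearMap =
      cocycles (conformalBivector Λ a) (conformalVector Λ E a) k := by
  ext d
  constructor
  · rintro ⟨c, ⟨hc, hc'⟩, rfl⟩
    refine ⟨map_rescale_cochains a b hab k ▸ Submodule.mem_map_of_mem hc, ?_⟩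
    refine (sigma_rescale hΛ hE a b hab k hc).trans ?_
    rw [show sigma Λ E k c = 0 from hc', map_zero]
  · rintro ⟨hd, hd'⟩
    rw [← map_rescale_cochains a b hab k] at hd
    obtain ⟨c, hc, rfl⟩ := hd
    refine ⟨c, ⟨hc, ?_⟩, rfl⟩
    have h := (sigma_rescale hΛ hE a b hab k hc).symm.trans hd'
    exact (LinearEquiv.map_eq_zero_iff _).mp h

theorem map_rescale_coboundaries {Λ : Alt n M 2} {E : Alt n M 1}
    (hΛ : Λ ∈ multivectorFields n M 2) (hE : E ∈ multivectorFields n M 1) (a b : SmoothFun n M)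
    (hab : a * b = 1) (k : ℕ) :
    (coboundaries Λ E k).map (rescale a b hab k).toLinearMap =
      coboundaries (conformalBivector Λ a) (conformalVector Λ E a) k := by
  cases k with
  | zero => exact Submodule.map_bot _
  | succ k =>
    change Submodule.map _ ((cochains n M k).map (sigma Λ E k)) = (cochains n M k).map _
    -- Writing the cochains one degree lower as a rescaled image makes both sides images of the same
    -- cochains under the two sides of `sigma_rescale`.
    conv_rhs => rw [← map_rescale_cochains a b hab k]
    ext d
    constructor
    · rintro ⟨_, ⟨c, hc, rfl⟩, rfl⟩
      exact ⟨_, ⟨c, hc, rfl⟩, sigma_rescale hΛ hE a b hab k hc⟩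
    · rintro ⟨_, ⟨c, hc, rfl⟩, rfl⟩
      exact ⟨_, ⟨c, hc, rfl⟩, (sigma_rescale hΛ hE a b hab k hc).symm⟩

/-- A linear isomorphism which maps `Z` onto `Z'` and `B` onto `B'` induces an isomorphism of the
quotients of `Z` by `B ∩ Z` and of `Z'` by `B' ∩ Z'`. -/
theorem nonempty_quotient_submoduleOf_equiv {V : Type*} [AddCommGroup V] [Module ℝ V]
    (e : V ≃ₗ[ℝ] V) {Z B Z' B' : Submodule ℝ V} (hZ : Z.map e.toLinearMap = Z')
    (hB : B.map e.toLinearMap = B') :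
    Nonempty ((Z ⧸ B.submoduleOf Z) ≃ₗ[ℝ] (Z' ⧸ B'.submoduleOf Z')) := by
  subst hZ hB
  refine ⟨Submodule.Quotient.equiv _ _ (e.submoduleMap Z) ?_⟩
  ext ⟨d, hd⟩
  obtain ⟨c, hc, rfl⟩ := hd
  constructor
  · rintro ⟨c', hc', h⟩
    rw [← h]
    exact ⟨c', hc', rfl⟩
  · rintro ⟨c', hc', h⟩
    obtain rfl : c' = c := e.injective h
    exact ⟨⟨c', hc⟩, hc', rfl⟩

/-- A smooth function without zeros has a smooth inverse. -/
theorem exists_mul_eq_one (a : SmoothFun n M) (ha : ∀ x, a x ≠ 0) :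
    ∃ b : SmoothFun n M, a * b = 1 :=
  ⟨⟨fun x => (a x)⁻¹, a.contMDiff.inv₀ ha⟩, by ext x; exact mul_inv_cancel₀ (ha x)⟩

end Manifold

end LichnerowiczJacobi

end
open LichnerowiczJacobi in
theorem theorem3p2 (n : ℕ) (M : Type*) [TopologicalSpace M] [T2Space M]
    [SecondCountableTopology M] [ChartedSpace (EuclideanSpace ℝ (Fin n)) M]
    [IsManifold (𝓡 n) ∞ M] (Λ : Alt n M 2) (E : Alt n M 1) (hJ : IsJacobi Λ E)
    (a : SmoothFun n M) (ha : ∀ x, 0 < a x) :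
    IsJacobi (conformalBivector Λ a) (conformalVector Λ E a) ∧
      ∀ k : ℕ, Nonempty (LJCohomology Λ E k ≃ₗ[ℝ]
        LJCohomology (conformalBivector Λ a) (conformalVector Λ E a) k) := by
  obtain ⟨b, hab⟩ := exists_mul_eq_one a fun x => (ha x).ne'
  exact ⟨hJ.conformal a, fun k => nonempty_quotient_submoduleOf_equiv (rescale a b hab k)
    (map_rescale_cocycles hJ.bivector hJ.vector a b hab k)
    (map_rescale_coboundaries hJ.bivector hJ.vector a b hab k)⟩
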